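/- Let $N\ge 2$, let $\Omega\subset\mathbb{R}^N$ be a bounded domain with $C^1$ boundary (for instance a bounded smooth domain), and let $0<s<1<p<\infty$. Write $$[u]_{s,p}^p=\iint_{\mathbb{R}^{2N}}\frac{|u(x)-u(y)|^p}{|x-y|^{N+sp}}\,dx\,dy,\qquad W_0^{s,p}(\Omega)=\{u\in L^p(\mathbb{R}^N):[u]_{s,p}<\infty,\ u=0\text{ in }\mathbb{R}^N\setminus\Omega\},$$ (this is the completion of $C_c^\infty(\Omega)$ in the norm $([u]_{s,p}^p+\|u\|_p^p)^{1/p}$), and for $u,v\in W_0^{s,p}(\Omega)$ $$\langle(-\Delta_p)^su,v\rangle=\iint_{\mathbb{R}^{2N}}\frac{|u(x)-u(y)|^{p-2}(u(x)-u(y))(v(x)-v(y))}{|x-y|^{N+sp}}\,dx\,dy .$$ Let $p_s^\star=\frac{Np}{N-sp}$ if $sp<N$ and $p_s^\star=\infty$ if $sp\ge N$, let $\|\cdot\|_q$ be the norm of $L^q(\Omega)$, and let $r'$ be the Hölder conjugate of $r$. **Theorem.** Let $\alpha>0$, $1\le r\le\infty$ and $\omega\in L^r(\Omega)$, with $pr'<p_s^\star$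 (so $r>1$). Suppose that $u\in W_0^{s,p}(\Omega)$ is positive a.e. in $\Omega$ and satisfies $$\langle(-\Delta_p)^su,\varphi\rangle\le\int_\Omega\frac{\omega\varphi}{u^\alpha}\,dx\qquad\text{for all }\varphi\in W_0^{s,p}(\Omega),\ \varphi\ge0,$$ where the inequality is only required for those $\varphi$ for which $\omega\varphi/u^\alpha$ is integrable over $\Omega$ (if $\omega\ge0$ it is trivially true for all others, the right-hand side being $+\infty$). Then $u\in L^\infty(\Omega)$. Moreover, for each $\theta$ with $pr'<\theta<p_s^\star$ there is a constant $S_\theta>0$ with $$S_\theta\,\|v\|_\theta^p\le[v]_{s,p}^p\qquad\text{for all }v\in W_0^{s,p}(\Omega),$$ and, for every such constant $S_\theta$, $$\|u\|_\infty\le C_\alpha\left(\frac{\|\omega\|_r}{S_\theta}\right)^{\frac1{p-1+\alpha}}2^{\frac{b(p-1)}{(b-1)(p-1+\alpha)}}\,|\Omega|^{\frac{(b-1)(p-1)}{\theta(p-1+\alpha)}},$$ where $$C_\alpha=\left(\frac{\alpha}{p-1}\right)^{\frac{p-1}{p-1+\alpha}}\left(1+\frac{p-1}{\alpha}\right),\qquad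 b=\left(\frac{\theta}{r'}-1\right)\frac1{p-1}>1 .$$ -/

import Mathlib

open MeasureTheory
open scoped ENNReal Topology

noncomputable section

/-- A bounded domain (nonempty, connected, open set) of `ℝ^N` with boundary of class `C^1`: near
each boundary point the domain is the set where a `C^1` function with nonvanishing differential
is negative. Every bounded smooth domain is of this kind. -/
structure IsBoundedC1Domain {N : ℕ} (Ω : Set (EuclideanSpace ℝ (Fin N))) : Prop where
  isOpen : IsOpen Ω
  isConnected : IsConnected Ω
  isBounded : Bornology.IsBounded Ω
  boundary : ∀ x ∈ frontier Ω, ∃ g : EuclideanSpace ℝ (Fin N) → ℝ,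
    ContDiff ℝ 1 g ∧ fderiv ℝ g x ≠ 0 ∧ ∀ᶠ y in 𝓝 x, (y ∈ Ω ↔ g y < 0)

/-- The `p`-th power `[u]_{s,p}^p` of the Gagliardo seminorm, the double integral over `ℝ^{2N}` of
`|u(x) - u(y)|^p / |x - y|^{N + sp}`, as a value in `[0, ∞]`. -/
def gagliardoPow {N : ℕ} (s p : ℝ) (u : EuclideanSpace ℝ (Fin N) → ℝ) : ℝ≥0∞ :=
  ∫⁻ z : EuclideanSpace ℝ (Fin N) × EuclideanSpace ℝ (Fin N),
    ENNReal.ofReal (|u z.1 - u z.2| ^ p / ‖z.1 - z.2‖ ^ ((N : ℝ) + s * p))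

/-- The fractional Sobolev space `W_0^{s,p}(Ω)`: the functions `u ∈ L^p(ℝ^N)` with
`[u]_{s,p} < ∞` and `u = 0` (almost everywhere) in `ℝ^N \ Ω`. -/
def SobolevW0 {N : ℕ} (s p : ℝ) (Ω : Set (EuclideanSpace ℝ (Fin N))) :
    Set (EuclideanSpace ℝ (Fin N) → ℝ) :=
  {u | MemLp u (ENNReal.ofReal p) volume ∧ gagliardoPow s p u < ∞ ∧ ∀ᵐ x, x ∉ Ω → u x = 0}

/-- The duality pairing `⟨(-Δ_p)^s u, v⟩`. For `u, v ∈ W_0^{s,p}(Ω)` the integrand is integrable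
by Hölder's inequality. -/
def fracPLaplacianPairing {N : ℕ} (s p : ℝ) (u v : EuclideanSpace ℝ (Fin N) → ℝ) : ℝ :=
  ∫ z : EuclideanSpace ℝ (Fin N) × EuclideanSpace ℝ (Fin N),
    |u z.1 - u z.2| ^ (p - 2) * (u z.1 - u z.2) * (v z.1 - v z.2) /
      ‖z.1 - z.2‖ ^ ((N : ℝ) + s * p)

/-- The critical exponent `p_s^*`: `Np / (N - sp)` if `sp < N`, and `∞` otherwise. -/
def criticalExponent (N : ℕ) (s p : ℝ) : ℝ≥0∞ :=
  if s * p < N then ENNReal.ofReal (N * p / (N - s * p)) else ∞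

/-- `S` is an admissible constant `S_θ` in the Sobolev inequality:
`S > 0` and `S ‖v‖_{L^θ(Ω)}^p ≤ [v]_{s,p}^p` for all `v ∈ W_0^{s,p}(Ω)`
(in `[0, ∞]`, so that `v ∈ L^θ(Ω)` is part of the inequality). -/
def IsSobolevConstant {N : ℕ} (s p : ℝ) (Ω : Set (EuclideanSpace ℝ (Fin N))) (θ S : ℝ) : Prop :=
  0 < S ∧ ∀ v ∈ SobolevW0 s p Ω,
    ENNReal.ofReal S * eLpNorm v (ENNReal.ofReal θ) (volume.restrict Ω) ^ p ≤ gagliardoPow s p v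

/-- `⟨(-Δ_p)^s u, φ⟩ ≤ ∫_Ω ω φ / u^α` for all `φ ∈ W_0^{s,p}(Ω)` with `φ ≥ 0`. The inequality is
only asked for when the integrand on the right is integrable. For `ω ≥ 0` this loses nothing: if
`ω φ / u^α` is not integrable then its integral is `+∞` and the inequality is trivially true. -/
def IsWeakSubsolution {N : ℕ} (s p α : ℝ) (Ω : Set (EuclideanSpace ℝ (Fin N)))
    (ω u : EuclideanSpace ℝ (Fin N) → ℝ) : Prop :=
  ∀ φ ∈ SobolevW0 s p Ω, (∀ᵐ x, 0 ≤ φ x) →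
    IntegrableOn (fun x => ω x * φ x / u x ^ α) Ω volume →
    fracPLaplacianPairing s p u φ ≤ ∫ x in Ω, ω x * φ x / u x ^ α

/-- The constant `C_α = (α / (p - 1))^{(p-1)/(p-1+α)} (1 + (p - 1) / α)`. -/
def constC (p α : ℝ) : ℝ :=
  (α / (p - 1)) ^ ((p - 1) / (p - 1 + α)) * (1 + (p - 1) / α)

/-- The exponent `b = (θ / r' - 1) / (p - 1)`, where `r'` is the Hölder conjugate of `r`. -/
def exponentB (p θ : ℝ) (r : ℝ≥0∞) : ℝ :=
  (θ / (ENNReal.conjExponent r).toReal - 1) * (1 / (p - 1))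

end

/-!
The bound is Stampacchia's truncation argument, and the Sobolev inequality it needs is proved by
comparing a function with its means over balls.

**Sobolev inequality.** Let `F(x) = ∫ |v(x) - v(y)|^p / |x - y|^{N + sp} dy`, so that
`∫ F = [v]_{s,p}^p`. Comparing `v(x)` with the mean of `v` over the ball of radius `R` around `x`
gives `|v(x)| ≤ c R^s F(x)^{1/p} + c R^{-N/θ} ‖v‖_θ` for every `R > 0`
(`enorm_le_gagliardoSlice_add_eLpNorm`). With the best `R` at each `x`, the `θ`-th power of the
right-hand side is a multiple of `F(x)^{e/p} ‖v‖_θ^{θ - e}`, where `e ≤ p` exactly when `θ` is at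
most critical. Integration over `Ω` and Jensen's inequality bound `‖v‖_θ^θ` by a multiple of
`[v]^e ‖v‖_θ^{θ - e}`, and `‖v‖_θ^{θ - e}` can be divided out as long as it is finite; truncation
and Fatou's lemma remove that proviso (`exists_isSobolevConstant`). The cases `sp < N` and
`sp ≥ N` are not distinguished, and of `Ω` only the finiteness of its measure is used.

**Boundedness.** For `k > 0` the function `(u - k)⁺` is an admissible test function, because
`u^{-α} ≤ k^{-α}` where it does not vanish. The pairing of `u` with it dominates
`[(u - k)⁺]_{s,p}^p`, so that the Sobolev and Hölder inequalities give
`S ‖(u - k)⁺‖_θ^{p-1} ≤ k^{-α} ‖ω‖_r |{u > k}|^{1/r' - 1/θ}` (`IsWeakSubsolution.energy_le`).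
By Chebyshev's inequality `|{u > h}|` is then at most a multiple of
`(h - k)^{-θ} |{u > k}|^b` with `b > 1` (`IsWeakSubsolution.measureReal_superlevel_le`), and
Stampacchia's lemma (`eq_zero_of_forall_le_div_rpow_mul_rpow`) yields
`‖u‖_∞ ≤ k + D k^{-α/(p-1)}` with an explicit `D`. The right-hand side is minimal at
`k^{1 + α/(p-1)} = α D / (p - 1)`, and its minimum is the stated bound
(`le_constC_mul_of_forall_le_add`).
-/

/-! ### Two elementary inequalities -/

/-- Optimising `A R ^ s + B R ^ (-t)` over `R > 0`, up to the factor `2`. -/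
lemma le_two_mul_rpow_mul_rpow_of_forall_le {s t a A B : ℝ} (hs : 0 < s) (ht : 0 < t)
    (hA : 0 ≤ A) (hB : 0 ≤ B)
    (h : ∀ R : ℝ, 0 < R → a ≤ A * R ^ s + B * R ^ (-t)) :
    a ≤ 2 * (A ^ (t / (s + t)) * B ^ (s / (s + t))) := by
  have hst : 0 < s + t := by positivity
  -- Perturbing `A` and `B` to positive numbers covers the cases `A = 0` and `B = 0`.
  have key : ∀ ε : ℝ, 0 < ε →
      a ≤ 2 * ((A + ε) ^ (t / (s + t)) * (B + ε) ^ (s / (s + t))) := by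
    intro ε hε
    have hA' : 0 < A + ε := by positivity
    have hB' : 0 < B + ε := by positivity
    set A' := A + ε
    set B' := B + ε
    -- The two terms are equal at this radius.
    have hR : 0 < (B' / A') ^ (1 / (s + t)) := by positivity
    have h1 := h _ hR
    have e1 : A' * ((B' / A') ^ (1 / (s + t))) ^ s
        = A' ^ (t / (s + t)) * B' ^ (s / (s + t)) := by
      rw [← Real.rpow_mul (by positivity), Real.div_rpow hB'.le hA'.le,
        show 1 / (s + t) * s = s / (s + t) by ring,
        show t / (s + t) = 1 - s / (s + t) by field_simp; ring, Real.rpow_sub hA', Real.rpow_one]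
      ring
    have e2 : B' * ((B' / A') ^ (1 / (s + t))) ^ (-t)
        = A' ^ (t / (s + t)) * B' ^ (s / (s + t)) := by
      rw [← Real.rpow_mul (by positivity), Real.div_rpow hB'.le hA'.le,
        show 1 / (s + t) * (-t) = -(t / (s + t)) by ring,
        show s / (s + t) = 1 + -(t / (s + t)) by field_simp; ring, Real.rpow_add hB',
        Real.rpow_one, Real.rpow_neg hA'.le]
      have : A' ^ (t / (s + t)) ≠ 0 := by positivity
      field_simp
    have m1 : A * ((B' / A') ^ (1 / (s + t))) ^ s ≤ A' * ((B' / A') ^ (1 / (s + t))) ^ s :=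
      mul_le_mul_of_nonneg_right (by simp [A', hε.le]) (by positivity)
    have m2 : B * ((B' / A') ^ (1 / (s + t))) ^ (-t)
        ≤ B' * ((B' / A') ^ (1 / (s + t))) ^ (-t) :=
      mul_le_mul_of_nonneg_right (by simp [B', hε.le]) (by positivity)
    linarith
  have hcont : Continuous
      fun ε : ℝ => 2 * ((A + ε) ^ (t / (s + t)) * (B + ε) ^ (s / (s + t))) := by
    have c1 : Continuous fun ε : ℝ => (A + ε) ^ (t / (s + t)) :=
      (continuous_const.add continuous_id).rpow_const fun _ => Or.inr (by positivity)
    have c2 : Continuous fun ε : ℝ => (B + ε) ^ (s / (s + t)) :=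
      (continuous_const.add continuous_id).rpow_const fun _ => Or.inr (by positivity)
    exact continuous_const.mul (c1.mul c2)
  have hlim := (hcont.tendsto 0).mono_left (nhdsWithin_le_nhds (s := Set.Ioi 0))
  simp only [add_zero] at hlim
  exact ge_of_tendsto hlim (Filter.eventually_of_mem self_mem_nhdsWithin fun ε hε => key ε hε)

lemma ENNReal.le_two_mul_rpow_mul_rpow_of_forall_le {s t : ℝ} {a A B : ℝ≥0∞} (hs : 0 < s)
    (ht : 0 < t) (ha : a ≠ ∞) (hA : A ≠ ∞) (hB : B ≠ ∞)
    (h : ∀ R : ℝ, 0 < R → a ≤ A * ENNReal.ofReal (R ^ s) + B * ENNReal.ofReal (R ^ (-t))) :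
    a ≤ 2 * (A ^ (t / (s + t)) * B ^ (s / (s + t))) := by
  have h1 := _root_.le_two_mul_rpow_mul_rpow_of_forall_le (a := a.toReal) (A := A.toReal)
    (B := B.toReal) hs ht ENNReal.toReal_nonneg ENNReal.toReal_nonneg ?_
  · rw [ENNReal.toReal_rpow, ENNReal.toReal_rpow, ← ENNReal.toReal_mul,
      ← ENNReal.toReal_ofNat, ← ENNReal.toReal_mul] at h1
    refine (ENNReal.toReal_le_toReal ha ?_).1 h1
    have : 0 ≤ t / (s + t) := by positivity
    have : 0 ≤ s / (s + t) := by positivity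
    finiteness
  · intro R hR
    have h2 := ENNReal.toReal_mono (by finiteness) (h R hR)
    rwa [ENNReal.toReal_add (by finiteness) (by finiteness), ENNReal.toReal_mul,
      ENNReal.toReal_mul, ENNReal.toReal_ofReal (by positivity),
      ENNReal.toReal_ofReal (by positivity)] at h2

/-- Jensen's inequality for `t ↦ t ^ q`, in the form of Hölder's inequality against `1`. -/
lemma lintegral_le_lintegral_rpow_mul_measure_univ {X : Type*} [MeasurableSpace X] {μ : Measure X}
    {f : X → ℝ≥0∞} (hf : AEMeasurable f μ) {q : ℝ} (hq : 1 ≤ q) :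
    ∫⁻ x, f x ∂μ ≤ (∫⁻ x, f x ^ q ∂μ) ^ (1 / q) * μ Set.univ ^ (1 - 1 / q) := by
  have hq0 : 0 < q := by linarith
  have h := ENNReal.lintegral_mul_norm_pow_le (μ := μ) (hf.pow_const q)
    (aemeasurable_const (b := (1 : ℝ≥0∞))) (p := 1 / q) (q := 1 - 1 / q) (by positivity)
    (by rw [sub_nonneg, div_le_one hq0]; exact hq) (by ring)
  simpa [← ENNReal.rpow_mul, hq0.ne'] using h

/-! ### The Sobolev inequality -/

section Sobolev

variable {N : ℕ} {s p : ℝ}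

lemma ofReal_abs_rpow {q a : ℝ} (hq : 0 ≤ q) : ENNReal.ofReal (|a| ^ q) = ‖a‖ₑ ^ q := by
  rw [← ENNReal.ofReal_rpow_of_nonneg (abs_nonneg a) hq, Real.enorm_eq_ofReal_abs]

lemma aemeasurable_gagliardo_integrand {u : EuclideanSpace ℝ (Fin N) → ℝ}
    (hu : AEMeasurable u) (s p : ℝ) :
    AEMeasurable (fun z : EuclideanSpace ℝ (Fin N) × EuclideanSpace ℝ (Fin N) =>
      |u z.1 - u z.2| ^ p / ‖z.1 - z.2‖ ^ ((N : ℝ) + s * p)) := by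
  have h1 : AEMeasurable (fun z : EuclideanSpace ℝ (Fin N) × EuclideanSpace ℝ (Fin N) => u z.1) :=
    hu.comp_quasiMeasurePreserving Measure.quasiMeasurePreserving_fst
  have h2 : AEMeasurable (fun z : EuclideanSpace ℝ (Fin N) × EuclideanSpace ℝ (Fin N) => u z.2) :=
    hu.comp_quasiMeasurePreserving Measure.quasiMeasurePreserving_snd
  have h3 : AEMeasurable
      (fun z : EuclideanSpace ℝ (Fin N) × EuclideanSpace ℝ (Fin N) => |u z.1 - u z.2|) := by
    simpa only [Real.norm_eq_abs, Pi.sub_apply] using (h1.sub h2).norm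
  refine (h3.pow_const p).div (Measurable.aemeasurable ?_)
  exact ((measurable_fst.sub measurable_snd).norm).pow_const _

/-- The seminorm decreases under maps that do not increase pointwise differences. -/
lemma gagliardoPow_mono {u v : EuclideanSpace ℝ (Fin N) → ℝ} (hp : 0 ≤ p)
    (h : ∀ x y, |v x - v y| ≤ |u x - u y|) : gagliardoPow s p v ≤ gagliardoPow s p u := by
  refine lintegral_mono fun z => ENNReal.ofReal_le_ofReal ?_
  have := h z.1 z.2
  gcongr

/-- The inner integral `∫ |v(x) - v(y)|^p / |x - y|^{N + sp} dy` of the Gagliardo seminorm. -/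
noncomputable def gagliardoSlice (s p : ℝ) (v : EuclideanSpace ℝ (Fin N) → ℝ)
    (x : EuclideanSpace ℝ (Fin N)) : ℝ≥0∞ :=
  ∫⁻ y, ENNReal.ofReal (|v x - v y| ^ p / ‖x - y‖ ^ ((N : ℝ) + s * p))

lemma lintegral_gagliardoSlice {v : EuclideanSpace ℝ (Fin N) → ℝ} (hv : AEMeasurable v) :
    ∫⁻ x, gagliardoSlice s p v x = gagliardoPow s p v :=
  (lintegral_prod _ (aemeasurable_gagliardo_integrand hv s p).ennreal_ofReal).symm

lemma aemeasurable_gagliardoSlice {v : EuclideanSpace ℝ (Fin N) → ℝ} (hv : AEMeasurable v) :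
    AEMeasurable (gagliardoSlice s p v) :=
  (aemeasurable_gagliardo_integrand hv s p).ennreal_ofReal.lintegral_prod_right'

/-- Comparison of `v(x)` with the mean of `v` over the ball of radius `R` around `x`: the
oscillation is controlled by `gagliardoSlice`, the mean by the `L^θ` norm. -/
lemma enorm_le_gagliardoSlice_add_eLpNorm (hs : 0 < s) (hp : 1 ≤ p) {θ : ℝ} (hθ : 1 ≤ θ)
    {v : EuclideanSpace ℝ (Fin N) → ℝ} (hv : AEMeasurable v) (x : EuclideanSpace ℝ (Fin N))
    {R : ℝ} (hR : 0 < R) :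
    ‖v x‖ₑ ≤
      volume (Metric.ball (0 : EuclideanSpace ℝ (Fin N)) 1) ^ (-(1 / p)) *
          gagliardoSlice s p v x ^ (1 / p) * ENNReal.ofReal (R ^ s) +
      volume (Metric.ball (0 : EuclideanSpace ℝ (Fin N)) 1) ^ (-(1 / θ)) *
          (∫⁻ y, ‖v y‖ₑ ^ θ) ^ (1 / θ) * ENNReal.ofReal (R ^ (-(N / θ))) := by
  have hp0 : 0 < p := by linarith
  have hθ0 : 0 < θ := by linarith
  set κ := volume (Metric.ball (0 : EuclideanSpace ℝ (Fin N)) 1) with hκ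
  have hκ0 : κ ≠ 0 := (Metric.measure_ball_pos _ _ one_pos).ne'
  have hκt : κ ≠ ∞ := measure_ball_lt_top.ne
  set B := Metric.ball x R with hB
  set m := volume B with hm
  have hmκ : m = ENNReal.ofReal (R ^ (N : ℝ)) * κ := by
    rw [hm, hB, Measure.addHaar_ball_of_pos _ _ hR]
    simp [hκ]
  have hm0 : m ≠ 0 := (Metric.measure_ball_pos _ _ hR).ne'
  have hmt : m ≠ ∞ := measure_ball_lt_top.ne
  have mpow : ∀ c : ℝ, m ^ c = κ ^ c * ENNReal.ofReal (R ^ (N * c)) := by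
    intro c
    rw [hmκ, ENNReal.mul_rpow_of_ne_zero (by simp; positivity) hκ0,
      ENNReal.ofReal_rpow_of_pos (by positivity), ← Real.rpow_mul hR.le, mul_comm]
  have osc : ∫⁻ y in B, ‖v x - v y‖ₑ ≤
      (ENNReal.ofReal (R ^ ((N : ℝ) + s * p)) * gagliardoSlice s p v x) ^ (1 / p) *
        m ^ (1 - 1 / p) := by
    have h1 := lintegral_le_lintegral_rpow_mul_measure_univ (μ := volume.restrict B)
      (f := fun y => ‖v x - v y‖ₑ) ((aemeasurable_const.sub hv.restrict).enorm) hp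
    rw [Measure.restrict_apply_univ] at h1
    refine h1.trans ?_
    gcongr
    rw [gagliardoSlice, ← lintegral_const_mul' _ _ ENNReal.ofReal_ne_top]
    refine le_trans ?_ (setLIntegral_le_lintegral B _)
    refine setLIntegral_mono' measurableSet_ball fun y hy => ?_
    rw [← ofReal_abs_rpow hp0.le, ← ENNReal.ofReal_mul (by positivity)]
    refine ENNReal.ofReal_le_ofReal ?_
    have hyR : ‖x - y‖ ≤ R := by
      rw [← dist_eq_norm, dist_comm]; exact (Metric.mem_ball.1 hy).le
    rcases eq_or_ne x y with rfl | hxy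
    · simp [Real.zero_rpow hp0.ne']
    have hd : 0 < ‖x - y‖ := norm_pos_iff.2 (sub_ne_zero.2 hxy)
    rw [← mul_div_assoc, le_div_iff₀ (by positivity), mul_comm]
    gcongr
  have mean : ∫⁻ y in B, ‖v y‖ₑ ≤ (∫⁻ y, ‖v y‖ₑ ^ θ) ^ (1 / θ) * m ^ (1 - 1 / θ) := by
    have h1 := lintegral_le_lintegral_rpow_mul_measure_univ (μ := volume.restrict B)
      (f := fun y => ‖v y‖ₑ) hv.restrict.enorm hθ
    rw [Measure.restrict_apply_univ] at h1
    refine h1.trans ?_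
    gcongr
    exact Measure.restrict_le_self
  have tri : ‖v x‖ₑ * m ≤ (∫⁻ y in B, ‖v x - v y‖ₑ) + ∫⁻ y in B, ‖v y‖ₑ := by
    rw [← setLIntegral_const, ← lintegral_add_right' _ hv.restrict.enorm]
    refine lintegral_mono fun y => ?_
    calc ‖v x‖ₑ = ‖(v x - v y) + v y‖ₑ := by rw [sub_add_cancel]
      _ ≤ _ := enorm_add_le _ _
  have hdiv : ‖v x‖ₑ ≤ ((∫⁻ y in B, ‖v x - v y‖ₑ) + ∫⁻ y in B, ‖v y‖ₑ) * m⁻¹ := by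
    rw [← div_eq_mul_inv]
    exact (ENNReal.le_div_iff_mul_le (Or.inl hm0) (Or.inl hmt)).2 tri
  have msub : ∀ c : ℝ, m ^ (1 - c) * m⁻¹ = m ^ (-c) := by
    intro c
    rw [← ENNReal.rpow_neg_one, ← ENNReal.rpow_add _ _ hm0 hmt]
    ring_nf
  have hosc' : (ENNReal.ofReal (R ^ ((N : ℝ) + s * p)) * gagliardoSlice s p v x) ^ (1 / p) *
        m ^ (1 - 1 / p) * m⁻¹
      = κ ^ (-(1 / p)) * gagliardoSlice s p v x ^ (1 / p) * ENNReal.ofReal (R ^ s) := by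
    have hRs : R ^ s = R ^ (((N : ℝ) + s * p) * (1 / p)) * R ^ (N * (-(1 / p))) := by
      rw [← Real.rpow_add hR]
      congr 1
      field_simp
      ring
    rw [mul_assoc, msub, mpow, ENNReal.mul_rpow_of_nonneg _ _ (by positivity),
      ENNReal.ofReal_rpow_of_pos (by positivity), ← Real.rpow_mul hR.le, hRs,
      ENNReal.ofReal_mul (by positivity)]
    ring
  have hmean' : (∫⁻ y, ‖v y‖ₑ ^ θ) ^ (1 / θ) * m ^ (1 - 1 / θ) * m⁻¹
      = κ ^ (-(1 / θ)) * (∫⁻ y, ‖v y‖ₑ ^ θ) ^ (1 / θ) * ENNReal.ofReal (R ^ (-(N / θ))) := by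
    rw [mul_assoc, msub, mpow, show (N : ℝ) * -(1 / θ) = -(N / θ) by ring]
    ring
  calc ‖v x‖ₑ ≤ _ := hdiv
    _ ≤ _ := mul_le_mul_left (add_le_add osc mean) _
    _ = _ := by rw [add_mul, hosc', hmean']

/-- The Sobolev inequality for functions already known to lie in `L^θ`. -/
lemma exists_lintegral_rpow_le_mul_gagliardoPow (hN : 0 < N)
    {Ω : Set (EuclideanSpace ℝ (Fin N))} (hΩm : MeasurableSet Ω) (hΩt : volume Ω ≠ ∞)
    (hs : 0 < s) (hp : 1 ≤ p) {θ : ℝ} (hθ : 1 ≤ θ) (hcrit : θ * (N - s * p) ≤ N * p) :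
    ∃ C : ℝ≥0∞, C ≠ ∞ ∧ ∀ v : EuclideanSpace ℝ (Fin N) → ℝ, AEMeasurable v →
      (∀ᵐ x, x ∉ Ω → v x = 0) → (∫⁻ y, ‖v y‖ₑ ^ θ) ≠ ∞ →
      gagliardoPow s p v ≠ ∞ →
      ((∫⁻ y, ‖v y‖ₑ ^ θ) ^ (1 / θ)) ^ p ≤ C * gagliardoPow s p v := by
  have hp0 : 0 < p := by linarith
  have hθ0 : 0 < θ := by linarith
  have hN0 : (0 : ℝ) < N := by exact_mod_cast hN
  set t : ℝ := N / θ with ht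
  have ht0 : 0 < t := by positivity
  have hst : 0 < s + t := by positivity
  -- After optimisation the slice enters with power `e / p`, which is at most `1` exactly when
  -- `θ` is at most critical.
  set e : ℝ := t / (s + t) * θ with he
  have he0 : 0 < e := by positivity
  have heθ : s / (s + t) * θ = θ - e := by rw [he]; field_simp; ring
  have heθ0 : 0 ≤ θ - e := by rw [← heθ]; positivity
  have hep : e ≤ p := by
    rw [he, ht, div_mul_eq_mul_div, div_le_iff₀ (by positivity)]
    have : (N : ℝ) / θ * θ = N := by field_simp
    rw [this, mul_add, ← sub_nonneg]
    have : p * s + p * (N / θ) - N = (N * p - θ * (N - s * p)) / θ := by field_simp; ring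
    rw [this]
    exact div_nonneg (by linarith) hθ0.le
  have hep1 : 0 ≤ 1 - e / p := by rw [sub_nonneg, div_le_one hp0]; exact hep
  set κ := volume (Metric.ball (0 : EuclideanSpace ℝ (Fin N)) 1) with hκ
  have hκ0 : κ ≠ 0 := (Metric.measure_ball_pos _ _ one_pos).ne'
  have hκt : κ ≠ ∞ := measure_ball_lt_top.ne
  have hκp : ∀ c : ℝ, κ ^ c ≠ ∞ := fun c => ENNReal.rpow_ne_top_of_ne_zero hκ0 hκt
  set K : ℝ≥0∞ := 2 ^ θ * ((κ ^ (-(1 / p))) ^ e * (κ ^ (-(1 / θ))) ^ (θ - e)) *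
    volume Ω ^ (1 - e / p) with hK
  have hKt : K ≠ ∞ := by
    have := hκp (-(1 / p))
    have := hκp (-(1 / θ))
    rw [hK]
    finiteness
  refine ⟨K ^ (p / e), by finiteness, fun v hv hv0 hVt hg => ?_⟩
  set V := (∫⁻ y, ‖v y‖ₑ ^ θ) ^ (1 / θ) with hV
  have hVt' : V ≠ ∞ := by rw [hV]; finiteness
  rcases eq_or_ne V 0 with hV0 | hV0
  · rw [hV0, ENNReal.zero_rpow_of_pos hp0]; exact zero_le
  have hFfin : ∀ᵐ x, gagliardoSlice s p v x < ∞ :=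
    ae_lt_top' (aemeasurable_gagliardoSlice hv) (by rw [lintegral_gagliardoSlice hv]; exact hg)
  have hpt : ∀ᵐ x, ‖v x‖ₑ ^ θ ≤ 2 ^ θ * ((κ ^ (-(1 / p))) ^ e * (κ ^ (-(1 / θ))) ^ (θ - e)) *
      V ^ (θ - e) * gagliardoSlice s p v x ^ (e / p) := by
    filter_upwards [hFfin] with x hx
    have h1 := ENNReal.le_two_mul_rpow_mul_rpow_of_forall_le (a := ‖v x‖ₑ)
      (A := κ ^ (-(1 / p)) * gagliardoSlice s p v x ^ (1 / p)) (B := κ ^ (-(1 / θ)) * V) hs ht0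
      enorm_ne_top
      (ENNReal.mul_ne_top (hκp _) (ENNReal.rpow_ne_top_of_nonneg (by positivity) hx.ne))
      (ENNReal.mul_ne_top (hκp _) hVt')
      (fun R hR => enorm_le_gagliardoSlice_add_eLpNorm hs hp hθ hv x hR)
    have h2 := ENNReal.rpow_le_rpow h1 hθ0.le
    refine h2.trans_eq ?_
    rw [ENNReal.mul_rpow_of_nonneg _ _ hθ0.le, ENNReal.mul_rpow_of_nonneg _ _ hθ0.le,
      ← ENNReal.rpow_mul, ← ENNReal.rpow_mul, ← he, heθ,
      ENNReal.mul_rpow_of_nonneg _ _ he0.le, ENNReal.mul_rpow_of_nonneg _ _ heθ0,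
      ← ENNReal.rpow_mul _ (1 / p) e, show 1 / p * e = e / p by ring]
    ring
  have hΩint : ∫⁻ y, ‖v y‖ₑ ^ θ = ∫⁻ y in Ω, ‖v y‖ₑ ^ θ := by
    rw [← lintegral_indicator hΩm]
    refine lintegral_congr_ae ?_
    filter_upwards [hv0] with x hx
    by_cases hxΩ : x ∈ Ω
    · simp [hxΩ]
    · simp [hxΩ, hx hxΩ, hθ0]
  have hJ : ∫⁻ x in Ω, gagliardoSlice s p v x ^ (e / p) ≤
      gagliardoPow s p v ^ (e / p) * volume Ω ^ (1 - e / p) := by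
    have h1 := lintegral_le_lintegral_rpow_mul_measure_univ (μ := volume.restrict Ω)
      (f := fun x => gagliardoSlice s p v x ^ (e / p))
      ((aemeasurable_gagliardoSlice hv).restrict.pow_const _) (q := p / e)
      ((one_le_div he0).2 hep)
    have hc : e / p * (p / e) = 1 := by field_simp
    simp only [← ENNReal.rpow_mul, hc, ENNReal.rpow_one, one_div_div,
      Measure.restrict_apply_univ] at h1
    refine h1.trans ?_
    gcongr
    rw [← lintegral_gagliardoSlice hv]
    exact setLIntegral_le_lintegral _ _
  have hmain : V ^ θ ≤ K * V ^ (θ - e) * gagliardoPow s p v ^ (e / p) := by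
    have hVθ : V ^ θ = ∫⁻ y in Ω, ‖v y‖ₑ ^ θ := by
      rw [hV, ← ENNReal.rpow_mul, one_div, inv_mul_cancel₀ hθ0.ne', ENNReal.rpow_one, hΩint]
    rw [hVθ]
    refine (lintegral_mono_ae (ae_restrict_of_ae hpt)).trans ?_
    have hct : 2 ^ θ * ((κ ^ (-(1 / p))) ^ e * (κ ^ (-(1 / θ))) ^ (θ - e)) * V ^ (θ - e)
        ≠ ∞ := by
      have := hκp (-(1 / p))
      have := hκp (-(1 / θ))
      finiteness
    rw [lintegral_const_mul' _ _ hct]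
    refine (mul_le_mul_right hJ _).trans_eq ?_
    rw [hK]
    ring
  have hVe : V ^ e ≤ K * gagliardoPow s p v ^ (e / p) := by
    have hVp0 : V ^ (θ - e) ≠ 0 := (ENNReal.rpow_pos hV0.bot_lt hVt').ne'
    have hVpt : V ^ (θ - e) ≠ ∞ := by finiteness
    rw [show θ = e + (θ - e) by ring, ENNReal.rpow_add _ _ hV0 hVt',
      show e + (θ - e) - e = θ - e by ring] at hmain
    rw [← ENNReal.mul_le_mul_iff_left hVp0 hVpt]
    refine hmain.trans_eq ?_
    ring
  have := ENNReal.rpow_le_rpow hVe (show 0 ≤ p / e by positivity)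
  rw [ENNReal.mul_rpow_of_nonneg _ _ (by positivity), ← ENNReal.rpow_mul V, ← ENNReal.rpow_mul (gagliardoPow s p v),
    show e * (p / e) = p by field_simp, show e / p * (p / e) = 1 by field_simp,
    ENNReal.rpow_one] at this
  exact this

/-- The Sobolev inequality on `W_0^{s,p}(Ω)` for a set `Ω` of finite measure and every
exponent up to the critical one. -/
theorem exists_isSobolevConstant (hN : 0 < N)
    {Ω : Set (EuclideanSpace ℝ (Fin N))} (hΩm : MeasurableSet Ω) (hΩt : volume Ω ≠ ∞)
    (hs : 0 < s) (hp : 1 ≤ p) {θ : ℝ} (hθ : 1 ≤ θ) (hcrit : θ * (N - s * p) ≤ N * p) :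
    ∃ S : ℝ, IsSobolevConstant s p Ω θ S := by
  have hp0 : 0 < p := by linarith
  have hθ0 : 0 < θ := by linarith
  obtain ⟨C, hC, h⟩ := exists_lintegral_rpow_le_mul_gagliardoPow hN hΩm hΩt hs hp hθ hcrit
  have key : ∀ v ∈ SobolevW0 s p Ω,
      eLpNorm v (ENNReal.ofReal θ) volume ^ p ≤ C * gagliardoPow s p v := by
    rintro v ⟨hvL, hg, hv0⟩
    have hvm : AEMeasurable v := hvL.1.aemeasurable
    have hθe : (ENNReal.ofReal θ) ≠ 0 := by simpa using hθ0
    -- Truncation at height `n` makes the norm finite and does not increase the seminorm.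
    set w : ℕ → EuclideanSpace ℝ (Fin N) → ℝ := fun n x => min |v x| n with hw
    have hwm : ∀ n, AEMeasurable (w n) := fun n => by
      have : AEMeasurable fun x => |v x| := by simpa only [Real.norm_eq_abs] using hvm.norm
      exact this.min aemeasurable_const
    have hw0 : ∀ n, ∀ᵐ x, x ∉ Ω → w n x = 0 := fun n => by
      filter_upwards [hv0] with x hx hxΩ
      simp [hw, hx hxΩ]
    have hwfin : ∀ n, ∫⁻ y, ‖w n y‖ₑ ^ θ ≠ ∞ := by
      intro n
      have : ∫⁻ y, ‖w n y‖ₑ ^ θ ≤ ∫⁻ y in Ω, (n : ℝ≥0∞) ^ θ := by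
        rw [← lintegral_indicator hΩm]
        refine lintegral_mono_ae ?_
        filter_upwards [hw0 n] with x hx
        by_cases hxΩ : x ∈ Ω
        · simp only [hxΩ, Set.indicator_of_mem]
          gcongr
          rw [Real.enorm_eq_ofReal (by positivity), ← ENNReal.ofReal_natCast n]
          exact ENNReal.ofReal_le_ofReal (min_le_right _ _)
        · simp [hxΩ, hx hxΩ, hθ0]
      refine ne_top_of_le_ne_top ?_ this
      rw [setLIntegral_const]
      finiteness
    have hwn : ∀ n, eLpNorm (w n) (ENNReal.ofReal θ) volume
        ≤ (C * gagliardoPow s p v) ^ (1 / p) := by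
      intro n
      rw [eLpNorm_eq_lintegral_rpow_enorm_toReal hθe ENNReal.ofReal_ne_top,
        ENNReal.toReal_ofReal hθ0.le]
      have hgw : gagliardoPow s p (w n) ≤ gagliardoPow s p v :=
        gagliardoPow_mono hp0.le fun x y => (abs_min_sub_min_le_max |v x| n |v y| n).trans
          (by simpa using abs_abs_sub_abs_le (v x) (v y))
      have h1 := (h (w n) (hwm n) (hw0 n) (hwfin n) (hgw.trans_lt hg).ne).trans
        (mul_le_mul_right hgw C)
      have h2 := ENNReal.rpow_le_rpow h1 (show 0 ≤ 1 / p by positivity)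
      rwa [← ENNReal.rpow_mul _ p, mul_one_div_cancel hp0.ne', ENNReal.rpow_one] at h2
    have hlim : eLpNorm (fun x => |v x|) (ENNReal.ofReal θ) volume ≤
        Filter.liminf (fun n => eLpNorm (w n) (ENNReal.ofReal θ) volume) Filter.atTop := by
      refine Lp.eLpNorm_lim_le_liminf_eLpNorm (fun n => (hwm n).aestronglyMeasurable) _ ?_
      refine Filter.Eventually.of_forall fun x => ?_
      obtain ⟨n, hn⟩ := exists_nat_ge |v x|
      refine tendsto_const_nhds.congr' ?_
      filter_upwards [Filter.eventually_ge_atTop n] with k hk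
      have : (n : ℝ) ≤ k := by exact_mod_cast hk
      exact (min_eq_left (hn.trans this)).symm
    have hle : eLpNorm v (ENNReal.ofReal θ) volume ≤ (C * gagliardoPow s p v) ^ (1 / p) := by
      have e1 : eLpNorm (fun x => |v x|) (ENNReal.ofReal θ) volume
          = eLpNorm v (ENNReal.ofReal θ) volume := eLpNorm_norm v
      rw [← e1]
      refine hlim.trans ?_
      refine (Filter.liminf_le_liminf (Filter.Eventually.of_forall hwn)).trans_eq ?_
      exact Filter.liminf_const _
    have h2 := ENNReal.rpow_le_rpow hle hp0.le
    rwa [← ENNReal.rpow_mul, one_div_mul_cancel hp0.ne', ENNReal.rpow_one] at h2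
  refine ⟨(C.toReal + 1)⁻¹, by positivity, fun v hv => ?_⟩
  have hC1 : C ≤ ENNReal.ofReal (C.toReal + 1) := by
    conv_lhs => rw [← ENNReal.ofReal_toReal hC]
    exact ENNReal.ofReal_le_ofReal (by linarith)
  rw [ENNReal.ofReal_inv_of_pos (by positivity), mul_comm, ← div_eq_mul_inv]
  refine ENNReal.div_le_of_le_mul' ?_
  calc eLpNorm v (ENNReal.ofReal θ) (volume.restrict Ω) ^ p
      ≤ eLpNorm v (ENNReal.ofReal θ) volume ^ p := by
        gcongr
        exact Measure.restrict_le_self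
    _ ≤ C * gagliardoPow s p v := key v hv
    _ ≤ _ := by gcongr

end Sobolev

/-! ### Stampacchia's iteration lemma -/

/-- Stampacchia's lemma. The smallest admissible `d` may be `0`, when `g` need not vanish at `k₀`
itself; hence the separate hypothesis `0 < d`. -/
lemma eq_zero_of_forall_le_div_rpow_mul_rpow {g : ℝ → ℝ} {k₀ K θ b G d : ℝ}
    (hg : ∀ k, 0 ≤ g k) (hanti : Antitone g) (hθ : 0 < θ) (hb : 1 < b) (hK : 0 ≤ K) (hG : 0 < G)
    (hgG : g k₀ ≤ G)
    (hdecay : ∀ k h, k₀ ≤ k → k < h → g h ≤ (K / (h - k)) ^ θ * g k ^ b)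
    (hd : 0 < d) (hKd : K * G ^ ((b - 1) / θ) * 2 ^ (b / (b - 1)) ≤ d) :
    g (k₀ + d) = 0 := by
  have hb1 : 0 < b - 1 := by linarith
  set μ := θ / (b - 1) with hμ
  have hμ0 : 0 < μ := by positivity
  have hθμ : θ = μ * (b - 1) := by rw [hμ]; field_simp
  -- Geometric decay of `g` along levels that approach `k₀ + d` geometrically.
  have key : ∀ n : ℕ, g (k₀ + d * (1 - (2 : ℝ) ^ (-(n : ℝ)))) ≤ G * 2 ^ (-(μ * n)) := by
    intro n
    induction n with
    | zero => simpa using hgG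
    | succ n ih =>
      set k := k₀ + d * (1 - (2 : ℝ) ^ (-(n : ℝ))) with hk
      set h := k₀ + d * (1 - (2 : ℝ) ^ (-((n + 1 : ℕ) : ℝ))) with hh
      have h2 : (2 : ℝ) ^ (-(n : ℝ)) = 2 * 2 ^ (-((n + 1 : ℕ) : ℝ)) := by
        rw [show (-(n : ℝ)) = 1 + -((n + 1 : ℕ) : ℝ) by push_cast; ring,
          Real.rpow_add (by norm_num), Real.rpow_one]
      have hle1 : (2 : ℝ) ^ (-(n : ℝ)) ≤ 1 :=
        Real.rpow_le_one_of_one_le_of_nonpos (by norm_num) (by simp)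
      have hpos : (0 : ℝ) < 2 ^ (-((n + 1 : ℕ) : ℝ)) := by positivity
      have hhk : h - k = d * 2 ^ (-((n + 1 : ℕ) : ℝ)) := by rw [hh, hk, h2]; ring
      have hhk0 : 0 < h - k := by rw [hhk]; positivity
      have hk0 : k₀ ≤ k := by
        have : 0 ≤ d * (1 - (2 : ℝ) ^ (-(n : ℝ))) := mul_nonneg hd.le (by linarith)
        linarith
      have hKle : K / (h - k) ≤
          2 ^ ((n + 1 : ℕ) : ℝ) * (G ^ (-((b - 1) / θ)) * 2 ^ (-(b / (b - 1)))) := by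
        rw [div_le_iff₀ hhk0, hhk, Real.rpow_neg hG.le, Real.rpow_neg (by norm_num),
          Real.rpow_neg (by norm_num)]
        have e : (2 : ℝ) ^ ((n + 1 : ℕ) : ℝ) * ((G ^ ((b - 1) / θ))⁻¹ * (2 ^ (b / (b - 1)))⁻¹) *
            (d * (2 ^ ((n + 1 : ℕ) : ℝ))⁻¹) = d / (G ^ ((b - 1) / θ) * 2 ^ (b / (b - 1))) := by
          field_simp
        rw [e, le_div_iff₀ (by positivity)]
        linarith
      have hKθ : (K / (h - k)) ^ θ ≤ G ^ (-(b - 1)) * 2 ^ (((n + 1 : ℕ) : ℝ) * θ - b * μ) := by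
        refine (Real.rpow_le_rpow (by positivity) hKle hθ.le).trans_eq ?_
        rw [Real.mul_rpow (by positivity) (by positivity),
          Real.mul_rpow (by positivity) (by positivity), ← Real.rpow_mul (by norm_num),
          ← Real.rpow_mul hG.le, ← Real.rpow_mul (by norm_num), Real.rpow_sub (by norm_num),
          show -((b - 1) / θ) * θ = -(b - 1) by field_simp,
          show -(b / (b - 1)) * θ = -(b * μ) by rw [hμ]; field_simp,
          Real.rpow_neg (by norm_num) (b * μ)]
        ring
      have hgb : g k ^ b ≤ G ^ b * 2 ^ (-(μ * n) * b) := by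
        refine (Real.rpow_le_rpow (hg k) ih (by linarith)).trans_eq ?_
        rw [Real.mul_rpow hG.le (by positivity), ← Real.rpow_mul (by norm_num)]
      calc g h ≤ (K / (h - k)) ^ θ * g k ^ b := hdecay k h hk0 (by linarith)
        _ ≤ (G ^ (-(b - 1)) * 2 ^ (((n + 1 : ℕ) : ℝ) * θ - b * μ)) *
            (G ^ b * 2 ^ (-(μ * n) * b)) :=
          mul_le_mul hKθ hgb (Real.rpow_nonneg (hg k) _) (by positivity)
        _ = (G ^ (-(b - 1)) * G ^ b) *
            (2 ^ (((n + 1 : ℕ) : ℝ) * θ - b * μ) * 2 ^ (-(μ * n) * b)) := by ring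
        _ = G * 2 ^ (-(μ * (n + 1 : ℕ))) := by
          rw [← Real.rpow_add hG, ← Real.rpow_add (by norm_num)]
          congr 1
          · rw [show -(b - 1) + b = 1 by ring, Real.rpow_one]
          · congr 1
            rw [hθμ]
            push_cast
            ring
  have hle : ∀ n : ℕ, g (k₀ + d) ≤ G * ((2 : ℝ) ^ (-μ)) ^ n := by
    intro n
    rw [← Real.rpow_natCast, ← Real.rpow_mul (by norm_num), neg_mul]
    refine (hanti ?_).trans (key n)
    have : (0 : ℝ) < 2 ^ (-(n : ℝ)) := by positivity
    nlinarith
  have hlim : Filter.Tendsto (fun n : ℕ => G * ((2 : ℝ) ^ (-μ)) ^ n) Filter.atTop (𝓝 (G * 0)) :=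
    (tendsto_pow_atTop_nhds_zero_of_lt_one (by positivity)
      (Real.rpow_lt_one_of_one_lt_of_neg (by norm_num) (by linarith))).const_mul G
  rw [mul_zero] at hlim
  exact le_antisymm (ge_of_tendsto' hlim hle) (hg _)

/-! ### Testing with truncations -/

section Truncation

variable {N : ℕ} {s p : ℝ}

lemma abs_rpow_le_abs_rpow_sub_two_mul {c d : ℝ} (hp : 1 < p) (hcd : 0 ≤ d * c)
    (h : |c| ≤ |d|) :
    |c| ^ p ≤ |d| ^ (p - 2) * d * c ∧ |d| ^ (p - 2) * d * c ≤ |d| ^ p := by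
  have hdc : |d| ^ (p - 2) * d * c = |d| ^ (p - 1) * |c| := by
    rcases eq_or_ne d 0 with rfl | hd
    · simp [Real.zero_rpow (sub_pos.2 hp).ne']
    rw [mul_assoc, ← abs_of_nonneg hcd, abs_mul, ← mul_assoc, ← Real.rpow_add_one (by simpa)]
    ring_nf
  have hpow : ∀ x : ℝ, |x| ^ p = |x| ^ (p - 1) * |x| := by
    intro x
    rw [← Real.rpow_add_one' (abs_nonneg x) (by linarith)]
    ring_nf
  have : 0 ≤ p - 1 := by linarith
  rw [hdc, hpow c, hpow d]
  constructor <;> gcongr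

lemma abs_max_sub_sub_max_sub_le (a b k : ℝ) :
    |max (a - k) 0 - max (b - k) 0| ≤ |a - b| := by
  simpa using abs_max_sub_max_le_abs (a - k) (b - k) 0

lemma sub_mul_max_sub_sub_max_sub_nonneg (a b k : ℝ) :
    0 ≤ (a - b) * (max (a - k) 0 - max (b - k) 0) := by
  rcases le_total a b with h | h
  · exact mul_nonneg_of_nonpos_of_nonpos (by linarith)
      (by linarith [max_le_max_right 0 (sub_le_sub_right h k)])
  · exact mul_nonneg (by linarith) (by linarith [max_le_max_right 0 (sub_le_sub_right h k)])

lemma max_sub_mem_sobolevW0 {Ω : Set (EuclideanSpace ℝ (Fin N))} (hp : 0 ≤ p)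
    {u : EuclideanSpace ℝ (Fin N) → ℝ} (hu : u ∈ SobolevW0 s p Ω) {k : ℝ} (hk : 0 ≤ k) :
    (fun x => max (u x - k) 0) ∈ SobolevW0 s p Ω := by
  obtain ⟨h1, h2, h3⟩ := hu
  refine ⟨h1.mono (((h1.1.aemeasurable.sub_const k).max aemeasurable_const).aestronglyMeasurable)
    (Filter.Eventually.of_forall fun x => ?_),
    (gagliardoPow_mono hp fun x y => abs_max_sub_sub_max_sub_le _ _ _).trans_lt h2, ?_⟩
  · rw [Real.norm_of_nonneg (le_max_right _ _), Real.norm_eq_abs]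
    exact max_le (by linarith [le_abs_self (u x)]) (abs_nonneg _)
  · filter_upwards [h3] with x hx hxΩ
    simp [hx hxΩ, hk]

/-- The energy of the truncation `(u - k)⁺` is at most the pairing of `u` with it. -/
lemma gagliardoPow_max_sub_le_pairing (hp : 1 < p) {u : EuclideanSpace ℝ (Fin N) → ℝ}
    (hu : AEMeasurable u) (hfin : gagliardoPow s p u ≠ ∞) (k : ℝ) :
    gagliardoPow s p (fun x => max (u x - k) 0) ≤
      ENNReal.ofReal (fracPLaplacianPairing s p u (fun x => max (u x - k) 0)) := by
  set φ : EuclideanSpace ℝ (Fin N) → ℝ := fun x => max (u x - k) 0 with hφ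
  have hpt : ∀ z : EuclideanSpace ℝ (Fin N) × EuclideanSpace ℝ (Fin N),
      |φ z.1 - φ z.2| ^ p ≤ |u z.1 - u z.2| ^ (p - 2) * (u z.1 - u z.2) * (φ z.1 - φ z.2) ∧
      |u z.1 - u z.2| ^ (p - 2) * (u z.1 - u z.2) * (φ z.1 - φ z.2) ≤ |u z.1 - u z.2| ^ p :=
    fun z => abs_rpow_le_abs_rpow_sub_two_mul hp (sub_mul_max_sub_sub_max_sub_nonneg _ _ _)
      (abs_max_sub_sub_max_sub_le _ _ _)
  have hnn : ∀ z : EuclideanSpace ℝ (Fin N) × EuclideanSpace ℝ (Fin N),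
      0 ≤ |u z.1 - u z.2| ^ (p - 2) * (u z.1 - u z.2) * (φ z.1 - φ z.2) /
        ‖z.1 - z.2‖ ^ ((N : ℝ) + s * p) := fun z =>
    div_nonneg ((by positivity : (0 : ℝ) ≤ _).trans (hpt z).1) (by positivity)
  have hφm : AEMeasurable φ := (hu.sub_const k).max aemeasurable_const
  have hdiff : ∀ {w : EuclideanSpace ℝ (Fin N) → ℝ}, AEMeasurable w → AEMeasurable
      (fun z : EuclideanSpace ℝ (Fin N) × EuclideanSpace ℝ (Fin N) => w z.1 - w z.2) :=
    fun hw => (hw.comp_quasiMeasurePreserving Measure.quasiMeasurePreserving_fst).sub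
      (hw.comp_quasiMeasurePreserving Measure.quasiMeasurePreserving_snd)
  have habs : AEMeasurable (fun z : EuclideanSpace ℝ (Fin N) × EuclideanSpace ℝ (Fin N) =>
      |u z.1 - u z.2|) := by
    simpa only [Real.norm_eq_abs] using (hdiff hu).norm
  have hm : AEMeasurable (fun z : EuclideanSpace ℝ (Fin N) × EuclideanSpace ℝ (Fin N) =>
      |u z.1 - u z.2| ^ (p - 2) * (u z.1 - u z.2) * (φ z.1 - φ z.2) /
        ‖z.1 - z.2‖ ^ ((N : ℝ) + s * p)) :=
    (((habs.pow_const _).mul (hdiff hu)).mul (hdiff hφm)).div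
      ((measurable_fst.sub measurable_snd).norm.pow_const _).aemeasurable
  have hint : Integrable (fun z : EuclideanSpace ℝ (Fin N) × EuclideanSpace ℝ (Fin N) =>
      |u z.1 - u z.2| ^ (p - 2) * (u z.1 - u z.2) * (φ z.1 - φ z.2) /
        ‖z.1 - z.2‖ ^ ((N : ℝ) + s * p)) := by
    refine ⟨hm.aestronglyMeasurable, ?_⟩
    rw [hasFiniteIntegral_iff_ofReal (Filter.Eventually.of_forall hnn)]
    refine lt_of_le_of_lt (lintegral_mono fun z => ENNReal.ofReal_le_ofReal ?_) hfin.lt_top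
    exact div_le_div_of_nonneg_right (hpt z).2 (by positivity)
  rw [fracPLaplacianPairing, ofReal_integral_eq_lintegral_ofReal hint
    (Filter.Eventually.of_forall hnn)]
  refine lintegral_mono fun z => ENNReal.ofReal_le_ofReal ?_
  exact div_le_div_of_nonneg_right (hpt z).1 (by positivity)

/-- A function supported in `A` satisfies Hölder's inequality with the measure of `A`. -/
lemma eLpNorm_le_eLpNorm_mul_rpow_measure_of_support {X : Type*} [MeasurableSpace X]
    {μ : Measure X} [SFinite μ] {f : X → ℝ} (hf : AEStronglyMeasurable f μ) {A : Set X}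
    (hA : ∀ x ∉ A, f x = 0) {q θ : ℝ≥0∞} (hqθ : q ≤ θ) :
    eLpNorm f q μ ≤ eLpNorm f θ μ * μ A ^ (1 / q.toReal - 1 / θ.toReal) := by
  have hind : (toMeasurable μ A).indicator f = f := by
    refine Set.indicator_eq_self.2 fun x hx => ?_
    by_contra hxA
    exact hx (hA x fun h => hxA (subset_toMeasurable μ A h))
  have h := eLpNorm_le_eLpNorm_mul_rpow_measure_univ (μ := μ.restrict (toMeasurable μ A)) hqθ
    hf.restrict
  rwa [← eLpNorm_indicator_eq_eLpNorm_restrict (measurableSet_toMeasurable μ A),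
    ← eLpNorm_indicator_eq_eLpNorm_restrict (measurableSet_toMeasurable μ A), hind,
    Measure.restrict_apply_univ, measure_toMeasurable] at h

variable {Ω : Set (EuclideanSpace ℝ (Fin N))} {α θ S : ℝ} {r : ℝ≥0∞}
  {ω u : EuclideanSpace ℝ (Fin N) → ℝ}

/-- The energy inequality for `(u - k)⁺`: where it does not vanish, `u ^ (-α) ≤ k ^ (-α)`. -/
lemma IsWeakSubsolution.energy_le (hΩt : volume Ω ≠ ∞) (hp : 1 < p) (hα : 0 < α)
    (hr : 1 ≤ r) (hθ : ENNReal.conjExponent r ≤ ENNReal.ofReal θ)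
    (hω : MemLp ω r (volume.restrict Ω)) (hu : u ∈ SobolevW0 s p Ω)
    (hu_pos : ∀ᵐ x ∂(volume.restrict Ω), 0 < u x) (hu_sub : IsWeakSubsolution s p α Ω ω u)
    (hS : IsSobolevConstant s p Ω θ S) {k : ℝ} (hk : 0 < k) :
    eLpNorm (fun x => max (u x - k) 0) (ENNReal.ofReal θ) (volume.restrict Ω) ≠ ∞ ∧
    ENNReal.ofReal S *
        eLpNorm (fun x => max (u x - k) 0) (ENNReal.ofReal θ) (volume.restrict Ω) ^ p ≤
      ENNReal.ofReal (k ^ (-α)) * (eLpNorm ω r (volume.restrict Ω) *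
        (eLpNorm (fun x => max (u x - k) 0) (ENNReal.ofReal θ) (volume.restrict Ω) *
          (volume.restrict Ω) {x | k < u x} ^
            (1 / (ENNReal.conjExponent r).toReal - 1 / (ENNReal.ofReal θ).toReal))) := by
  have hp0 : 0 < p := by linarith
  have : IsFiniteMeasure (volume.restrict Ω) := isFiniteMeasure_restrict.2 hΩt
  have := ENNReal.HolderConjugate.conjExponent hr
  set q := ENNReal.conjExponent r
  set φ : EuclideanSpace ℝ (Fin N) → ℝ := fun x => max (u x - k) 0 with hφ
  have hφW : φ ∈ SobolevW0 s p Ω := max_sub_mem_sobolevW0 hp0.le hu hk.le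
  have hφm : AEStronglyMeasurable φ (volume.restrict Ω) := hφW.1.1.restrict
  have hum : AEMeasurable u := hu.1.1.aemeasurable
  have hsob := hS.2 φ hφW
  have hΦt : eLpNorm φ (ENNReal.ofReal θ) (volume.restrict Ω) ≠ ∞ := by
    intro htop
    rw [htop, ENNReal.top_rpow_of_pos hp0, ENNReal.mul_top (by simpa using hS.1)] at hsob
    exact hφW.2.1.not_ge hsob
  refine ⟨hΦt, ?_⟩
  have hφθ : MemLp φ (ENNReal.ofReal θ) (volume.restrict Ω) := ⟨hφm, hΦt.lt_top⟩
  have hωφ : Integrable (fun x => ω x * φ x) (volume.restrict Ω) :=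
    hω.integrable_mul (hφθ.mono_exponent hθ)
  have hbound : ∀ᵐ x ∂(volume.restrict Ω),
      ‖ω x * φ x / u x ^ α‖ ≤ k ^ (-α) * ‖ω x * φ x‖ := by
    filter_upwards [hu_pos] with x hx
    rcases le_or_gt (u x) k with hxk | hxk
    · have : φ x = 0 := max_eq_right (by linarith)
      simp [this]
    · rw [norm_div, Real.norm_of_nonneg (Real.rpow_nonneg hx.le α), Real.rpow_neg hk.le,
        inv_mul_eq_div]
      gcongr
  have hint : IntegrableOn (fun x => ω x * φ x / u x ^ α) Ω volume :=
    (hωφ.norm.const_mul (k ^ (-α))).mono'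
      (hωφ.aemeasurable.div (hum.restrict.pow_const α)).aestronglyMeasurable hbound
  have hRHS : ENNReal.ofReal (∫ x in Ω, ω x * φ x / u x ^ α) ≤
      ENNReal.ofReal (k ^ (-α)) * eLpNorm (ω • φ) 1 (volume.restrict Ω) := by
    rw [eLpNorm_one_eq_lintegral_enorm, ← lintegral_const_mul' _ _ ENNReal.ofReal_ne_top]
    refine (Real.ofReal_le_enorm _).trans ((enorm_integral_le_lintegral_enorm _).trans ?_)
    refine lintegral_mono_ae ?_
    filter_upwards [hbound] with x hx
    rw [← ofReal_norm, ← ofReal_norm, ← ENNReal.ofReal_mul (by positivity)]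
    exact ENNReal.ofReal_le_ofReal hx
  calc ENNReal.ofReal S * eLpNorm φ (ENNReal.ofReal θ) (volume.restrict Ω) ^ p
      ≤ gagliardoPow s p φ := hsob
    _ ≤ ENNReal.ofReal (fracPLaplacianPairing s p u φ) :=
      gagliardoPow_max_sub_le_pairing hp hum hu.2.1.ne k
    _ ≤ ENNReal.ofReal (∫ x in Ω, ω x * φ x / u x ^ α) :=
      ENNReal.ofReal_le_ofReal (hu_sub φ hφW (Filter.Eventually.of_forall fun x =>
        le_max_right _ _) hint)
    _ ≤ _ := hRHS
    _ ≤ _ := by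
      gcongr
      refine (eLpNorm_smul_le_mul_eLpNorm (p := r) (q := q) hφm hω.1).trans ?_
      gcongr
      refine eLpNorm_le_eLpNorm_mul_rpow_measure_of_support hφm (fun x hx => ?_) hθ
      exact max_eq_right (by linarith [not_lt.1 (show ¬k < u x from hx)])

/-- Decay of the measures of the superlevel sets of a subsolution. -/
lemma IsWeakSubsolution.measureReal_superlevel_le (hΩt : volume Ω ≠ ∞) (hp : 1 < p)
    (hα : 0 < α) (hr : 1 ≤ r) (hθ0 : 0 < θ)
    (hθ : ENNReal.conjExponent r ≤ ENNReal.ofReal θ)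
    (hω : MemLp ω r (volume.restrict Ω)) (hu : u ∈ SobolevW0 s p Ω)
    (hu_pos : ∀ᵐ x ∂(volume.restrict Ω), 0 < u x) (hu_sub : IsWeakSubsolution s p α Ω ω u)
    (hS : IsSobolevConstant s p Ω θ S) {k h : ℝ} (hk : 0 < k) (hkh : k < h) :
    (volume.restrict Ω).real {x | h < u x} ≤
      (((eLpNorm ω r (volume.restrict Ω)).toReal / S * k ^ (-α)) ^ (1 / (p - 1)) / (h - k)) ^ θ *
        (volume.restrict Ω).real {x | k < u x} ^ exponentB p θ r := by
  have hp1 : 0 < p - 1 := by linarith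
  have hp0 : 0 < p := by linarith
  have : IsFiniteMeasure (volume.restrict Ω) := isFiniteMeasure_restrict.2 hΩt
  obtain ⟨hΦt, hE⟩ := hu_sub.energy_le hΩt hp hα hr hθ hω hu hu_pos hS hk
  have hS0 := hS.1
  set q := ENNReal.conjExponent r with hq
  have hq1 : 1 ≤ q := le_self_add
  have hqt : q ≠ ∞ := ne_top_of_le_ne_top ENNReal.ofReal_ne_top hθ
  have hq0 : 0 < q.toReal := ENNReal.toReal_pos (by positivity) hqt
  have hqθ : q.toReal ≤ θ := by
    rw [← ENNReal.toReal_ofReal hθ0.le]; exact ENNReal.toReal_mono ENNReal.ofReal_ne_top hθ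
  set φ : EuclideanSpace ℝ (Fin N) → ℝ := fun x => max (u x - k) 0 with hφ
  have hφm : AEStronglyMeasurable φ (volume.restrict Ω) :=
    (max_sub_mem_sobolevW0 hp0.le hu hk.le).1.1.restrict
  set Φ := eLpNorm φ (ENNReal.ofReal θ) (volume.restrict Ω) with hΦ
  set W := eLpNorm ω r (volume.restrict Ω) with hW
  have hWt : W ≠ ∞ := hω.2.ne
  rw [ENNReal.toReal_ofReal hθ0.le] at hE
  set c := 1 / q.toReal - 1 / θ with hc
  have hc0 : 0 ≤ c := by rw [hc, sub_nonneg]; exact one_div_le_one_div_of_le hq0 hqθ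
  have hcB : c / (p - 1) * θ = exponentB p θ r := by
    rw [hc, exponentB, ← hq]; field_simp
  -- The energy inequality, divided by `Φ`.
  have hE' : Φ.toReal ^ (p - 1) ≤
      W.toReal / S * k ^ (-α) * (volume.restrict Ω).real {x | k < u x} ^ c := by
    have h1 := ENNReal.toReal_mono (by finiteness) hE
    rw [ENNReal.toReal_mul, ENNReal.toReal_mul, ENNReal.toReal_mul, ENNReal.toReal_mul,
      ENNReal.toReal_ofReal hS0.le, ENNReal.toReal_ofReal (by positivity),
      ← ENNReal.toReal_rpow, ← ENNReal.toReal_rpow, ← measureReal_def] at h1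
    rcases eq_or_lt_of_le (ENNReal.toReal_nonneg (a := Φ)) with h0 | h0
    · rw [← h0, Real.zero_rpow hp1.ne']
      positivity
    have h2 : Φ.toReal ^ p = Φ.toReal ^ (p - 1) * Φ.toReal := by
      rw [← Real.rpow_add_one h0.ne']; ring_nf
    rw [h2] at h1
    rw [div_mul_eq_mul_div, div_mul_eq_mul_div, le_div_iff₀ hS0]
    refine le_of_mul_le_mul_right ?_ h0
    linarith
  have hcheb : (h - k) ^ θ * (volume.restrict Ω).real {x | h < u x} ≤ Φ.toReal ^ θ := by
    have h1 := mul_meas_ge_le_pow_eLpNorm' (volume.restrict Ω) (p := ENNReal.ofReal θ)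
      (by simpa using hθ0) ENNReal.ofReal_ne_top hφm (ENNReal.ofReal (h - k))
    rw [ENNReal.toReal_ofReal hθ0.le] at h1
    have h2 : (volume.restrict Ω) {x | h < u x} ≤
        (volume.restrict Ω) {x | ENNReal.ofReal (h - k) ≤ ‖φ x‖ₑ} := by
      refine measure_mono fun x hx => ?_
      have hx' : h < u x := hx
      refine (ENNReal.ofReal_le_ofReal ?_).trans (Real.ofReal_le_enorm _)
      exact le_max_of_le_left (by linarith)
    have h3 := ENNReal.toReal_mono (by finiteness) ((mul_le_mul_right h2 _).trans h1)
    rwa [ENNReal.toReal_mul, ← ENNReal.toReal_rpow, ← ENNReal.toReal_rpow,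
      ENNReal.toReal_ofReal (by linarith), ← measureReal_def] at h3
  have hhk : 0 < h - k := by linarith
  have hM : 0 ≤ W.toReal / S * k ^ (-α) := by positivity
  have hΦle : Φ.toReal ≤ (W.toReal / S * k ^ (-α)) ^ (1 / (p - 1)) *
      (volume.restrict Ω).real {x | k < u x} ^ (c / (p - 1)) := by
    have h1 := Real.rpow_le_rpow (by positivity) hE' (show 0 ≤ 1 / (p - 1) by positivity)
    rwa [← Real.rpow_mul ENNReal.toReal_nonneg, mul_one_div_cancel hp1.ne', Real.rpow_one,
      Real.mul_rpow hM (by positivity), ← Real.rpow_mul measureReal_nonneg, mul_one_div] at h1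
  rw [Real.div_rpow (by positivity) hhk.le, div_mul_eq_mul_div, le_div_iff₀ (by positivity),
    mul_comm, ← hcB, Real.rpow_mul measureReal_nonneg, ← Real.mul_rpow (by positivity)
      (by positivity)]
  exact hcheb.trans (Real.rpow_le_rpow ENNReal.toReal_nonneg hΦle hθ0.le)

/-- The bound given by truncation above the level `k`, for an arbitrary `k > 0`. -/
lemma IsWeakSubsolution.eLpNorm_top_le_add (hΩ0 : volume Ω ≠ 0) (hΩt : volume Ω ≠ ∞)
    (hp : 1 < p) (hα : 0 < α) (hr : 1 ≤ r) (hθ0 : 0 < θ)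
    (hθ : ENNReal.conjExponent r ≤ ENNReal.ofReal θ) (hb : 1 < exponentB p θ r)
    (hω : MemLp ω r (volume.restrict Ω)) (hu : u ∈ SobolevW0 s p Ω)
    (hu_pos : ∀ᵐ x ∂(volume.restrict Ω), 0 < u x) (hu_sub : IsWeakSubsolution s p α Ω ω u)
    (hS : IsSobolevConstant s p Ω θ S) {k : ℝ} (hk : 0 < k) :
    eLpNorm u ∞ (volume.restrict Ω) ≤ ENNReal.ofReal (k +
      ((eLpNorm ω r (volume.restrict Ω)).toReal / S * k ^ (-α)) ^ (1 / (p - 1)) *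
        (volume Ω).toReal ^ ((exponentB p θ r - 1) / θ) *
        2 ^ (exponentB p θ r / (exponentB p θ r - 1))) := by
  have : IsFiniteMeasure (volume.restrict Ω) := isFiniteMeasure_restrict.2 hΩt
  have hS0 := hS.1
  have hp1 : 0 < p - 1 := by linarith
  set M := (eLpNorm ω r (volume.restrict Ω)).toReal / S with hM
  have hM0 : 0 ≤ M := by positivity
  set d₀ := (M * k ^ (-α)) ^ (1 / (p - 1)) * (volume Ω).toReal ^ ((exponentB p θ r - 1) / θ) *
    2 ^ (exponentB p θ r / (exponentB p θ r - 1)) with hd₀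
  have hd₀0 : 0 ≤ d₀ := by positivity
  have key : ∀ d : ℝ, 0 < d → d₀ ≤ d → eLpNorm u ∞ (volume.restrict Ω) ≤
      ENNReal.ofReal (k + d) := by
    intro d hd hdd
    have h0 := eq_zero_of_forall_le_div_rpow_mul_rpow
      (g := fun l => (volume.restrict Ω).real {x | l < u x}) (k₀ := k) (θ := θ)
      (b := exponentB p θ r) (K := (M * k ^ (-α)) ^ (1 / (p - 1)))
      (G := (volume Ω).toReal) (d := d) (fun _ => measureReal_nonneg)
      (fun l l' hl => measureReal_mono fun x (hx : l' < u x) => hl.trans_lt hx) hθ0 hb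
      (by positivity) (ENNReal.toReal_pos hΩ0 hΩt) ?_ ?_ hd hdd
    · rw [measureReal_eq_zero_iff] at h0
      refine (eLpNorm_exponent_top (f := u)).trans_le (eLpNormEssSup_le_of_ae_bound ?_)
      filter_upwards [measure_eq_zero_iff_ae_notMem.1 h0, hu_pos] with x hx hx0
      rw [Real.norm_of_nonneg hx0.le]
      exact not_lt.1 hx
    · rw [← Measure.restrict_apply_univ, ← measureReal_def]
      exact measureReal_mono (Set.subset_univ _)
    · intro l h hl hlh
      refine (hu_sub.measureReal_superlevel_le hΩt hp hα hr hθ0 hθ hω hu hu_pos hS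
        (hk.trans_le hl) hlh).trans ?_
      have hl0 : 0 < l := hk.trans_le hl
      have hlk : l ^ (-α) ≤ k ^ (-α) := Real.rpow_le_rpow_of_nonpos hk hl (by linarith)
      have : 0 < h - l := by linarith
      gcongr
  rcases eq_or_lt_of_le hd₀0 with h0 | h0
  · refine le_of_forall_gt_imp_ge_of_dense fun y hy => ?_
    rw [← h0, add_zero] at hy
    rcases eq_or_ne y ∞ with rfl | hyt
    · exact le_top
    have hky : k < y.toReal := (ENNReal.ofReal_lt_iff_lt_toReal hk.le hyt).1 hy
    have := key (y.toReal - k) (by linarith) (by linarith)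
    rwa [add_sub_cancel, ENNReal.ofReal_toReal hyt] at this
  · exact key d₀ h0 le_rfl

/-- Optimisation over the truncation level `k`. With `D = M ^ (1 / (p - 1)) * E`, the right-hand
side of `h` is least where `k = (α / (p - 1)) D k ^ (-α / (p - 1))`. -/
lemma le_constC_mul_of_forall_le_add {a M E : ℝ} (hp : 1 < p) (hα : 0 < α) (hM : 0 ≤ M)
    (hE : 0 ≤ E)
    (h : ∀ k : ℝ, 0 < k → a ≤ k + (M * k ^ (-α)) ^ (1 / (p - 1)) * E) :
    a ≤ constC p α * M ^ (1 / (p - 1 + α)) * E ^ ((p - 1) / (p - 1 + α)) := by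
  have hp1 : 0 < p - 1 := by linarith
  have hpα : 0 < p - 1 + α := by linarith
  set β := α / (p - 1) with hβ
  have hβ0 : 0 < β := by positivity
  have hβ1 : (p - 1) / (p - 1 + α) = 1 / (1 + β) := by rw [hβ]; field_simp
  set D := M ^ (1 / (p - 1)) * E with hD
  have hD0 : 0 ≤ D := by positivity
  have hk : ∀ k : ℝ, 0 < k → a ≤ k + D * k ^ (-β) := by
    intro k hk
    have := h k hk
    rw [Real.mul_rpow hM (by positivity), ← Real.rpow_mul hk.le,
      show -α * (1 / (p - 1)) = -β by rw [hβ]; ring] at this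
    linarith
  have hgoal : constC p α * M ^ (1 / (p - 1 + α)) * E ^ ((p - 1) / (p - 1 + α)) =
      β ^ (1 / (1 + β)) * (1 + 1 / β) * D ^ (1 / (1 + β)) := by
    rw [constC, hD, Real.mul_rpow (by positivity) hE, ← Real.rpow_mul hM, ← hβ1, ← hβ,
      show 1 / (p - 1) * ((p - 1) / (p - 1 + α)) = 1 / (p - 1 + α) by field_simp,
      show (p - 1) / α = 1 / β by rw [hβ]; field_simp]
    ring
  rw [hgoal]
  rcases eq_or_lt_of_le hD0 with h0 | h0
  · have ha : a ≤ 0 := le_of_forall_gt_imp_ge_of_dense fun k hk0 => by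
      simpa [← h0] using hk k hk0
    rw [← h0, Real.zero_rpow (by positivity), mul_zero]
    exact ha
  set l := (β * D) ^ (1 / (1 + β)) with hl
  have hl0 : 0 < l := by positivity
  have hl1 : D * l ^ (-β) = l / β := by
    have h1 : l ^ (1 + β) = β * D := by
      rw [hl, ← Real.rpow_mul (by positivity), one_div_mul_cancel (by positivity), Real.rpow_one]
    rw [Real.rpow_add hl0, Real.rpow_one] at h1
    rw [Real.rpow_neg hl0.le]
    have : l ^ β ≠ 0 := by positivity
    field_simp
    linarith
  have := hk l hl0
  rw [hl1] at this
  refine this.trans_eq ?_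
  rw [hl, Real.mul_rpow hβ0.le h0.le]
  ring

end Truncation

/-! ### Exponents and the conclusion -/

lemma mul_sub_le_of_lt_criticalExponent {N : ℕ} {s p θ : ℝ} (hp : 0 < p) (hθ : 0 ≤ θ)
    (h : ENNReal.ofReal θ < criticalExponent N s p) : θ * (N - s * p) ≤ N * p := by
  rw [criticalExponent] at h
  split_ifs at h with hsp
  · have h1 := (ENNReal.ofReal_lt_ofReal_iff_of_nonneg hθ).1 h
    exact ((lt_div_iff₀ (by linarith)).1 h1).le
  · have : θ * (N - s * p) ≤ 0 := mul_nonpos_of_nonneg_of_nonpos hθ (by linarith)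
    have : (0 : ℝ) ≤ N * p := by positivity
    linarith

lemma one_lt_exponentB {p θ : ℝ} {r : ℝ≥0∞} (hp : 1 < p)
    (h : ENNReal.ofReal p * ENNReal.conjExponent r < ENNReal.ofReal θ) :
    ENNReal.conjExponent r < ENNReal.ofReal θ ∧ p < θ ∧ 1 < exponentB p θ r := by
  have hp0 : 0 < p := by linarith
  have hp1 : 0 < p - 1 := by linarith
  have hq1 : 1 ≤ ENNReal.conjExponent r := le_self_add
  have hpe : (1 : ℝ≥0∞) ≤ ENNReal.ofReal p := by simpa using hp.le
  have hqθ : ENNReal.conjExponent r < ENNReal.ofReal θ :=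
    (le_mul_of_one_le_left' hpe).trans_lt h
  have hqt := (hqθ.trans ENNReal.ofReal_lt_top).ne
  have hq0 : 0 < (ENNReal.conjExponent r).toReal := ENNReal.toReal_pos (by positivity) hqt
  refine ⟨hqθ, ?_, ?_⟩
  · exact (ENNReal.ofReal_lt_ofReal_iff_of_nonneg hp0.le).1
      ((le_mul_of_one_le_right' hq1).trans_lt h)
  · have h1 := (ENNReal.toReal_lt_toReal h.ne_top ENNReal.ofReal_ne_top).2 h
    have hθ0 : 0 ≤ θ := (ENNReal.ofReal_pos.1 (bot_le.trans_lt hqθ)).le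
    rw [ENNReal.toReal_mul, ENNReal.toReal_ofReal hp0.le, ENNReal.toReal_ofReal hθ0] at h1
    rw [exponentB, mul_one_div, one_lt_div hp1]
    have := (lt_div_iff₀ hq0).2 h1
    linarith

theorem mainTheorem8 {N : ℕ} (hN : 2 ≤ N) {Ω : Set (EuclideanSpace ℝ (Fin N))}
    (hΩ : IsBoundedC1Domain Ω) {s p : ℝ} (hs0 : 0 < s) (hs1 : s < 1) (hp : 1 < p)
    {α : ℝ} (hα : 0 < α) {r : ℝ≥0∞} (hr : 1 ≤ r)
    (hpr : ENNReal.ofReal p * ENNReal.conjExponent r < criticalExponent N s p)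
    {ω : EuclideanSpace ℝ (Fin N) → ℝ} (hω : MemLp ω r (volume.restrict Ω))
    {u : EuclideanSpace ℝ (Fin N) → ℝ} (hu : u ∈ SobolevW0 s p Ω)
    (hu_pos : ∀ᵐ x ∂(volume.restrict Ω), 0 < u x)
    (hu_sub : IsWeakSubsolution s p α Ω ω u) :
    MemLp u ∞ (volume.restrict Ω) ∧
    ∀ θ : ℝ, ENNReal.ofReal p * ENNReal.conjExponent r < ENNReal.ofReal θ →
      ENNReal.ofReal θ < criticalExponent N s p →
      1 < exponentB p θ r ∧
      (∃ S : ℝ, IsSobolevConstant s p Ω θ S) ∧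
      ∀ S : ℝ, IsSobolevConstant s p Ω θ S →
        (eLpNorm u ∞ (volume.restrict Ω)).toReal ≤
          constC p α *
            ((eLpNorm ω r (volume.restrict Ω)).toReal / S) ^ (1 / (p - 1 + α)) *
            (2 : ℝ) ^ (exponentB p θ r * (p - 1) / ((exponentB p θ r - 1) * (p - 1 + α))) *
            (volume Ω).toReal ^ ((exponentB p θ r - 1) * (p - 1) / (θ * (p - 1 + α))) := by
  have hΩt : volume Ω ≠ ∞ := hΩ.isBounded.measure_lt_top.ne
  have hΩ0 : volume Ω ≠ 0 := (hΩ.isOpen.measure_pos _ hΩ.isConnected.nonempty).ne'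
  have hsob : ∀ θ : ℝ, p < θ → ENNReal.ofReal θ < criticalExponent N s p →
      ∃ S : ℝ, IsSobolevConstant s p Ω θ S := fun θ hpθ hθc =>
    exists_isSobolevConstant (by omega) hΩ.isOpen.measurableSet hΩt hs0 hp.le (by linarith)
      (mul_sub_le_of_lt_criticalExponent (by linarith) (by linarith) hθc)
  have hmem : MemLp u ∞ (volume.restrict Ω) := by
    obtain ⟨η, hη1, hη2⟩ := exists_between hpr
    rw [← ENNReal.ofReal_toReal hη2.ne_top] at hη1 hη2
    obtain ⟨hqη, hpη, hb⟩ := one_lt_exponentB hp hη1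
    obtain ⟨S, hS⟩ := hsob _ hpη hη2
    exact ⟨hu.1.1.restrict, (hu_sub.eLpNorm_top_le_add hΩ0 hΩt hp hα hr (by linarith) hqη.le hb hω
      hu hu_pos hS one_pos).trans_lt ENNReal.ofReal_lt_top⟩
  refine ⟨hmem, fun θ hθ hθc => ?_⟩
  obtain ⟨hqθ, hpθ, hb⟩ := one_lt_exponentB hp hθ
  refine ⟨hb, hsob θ hpθ hθc, fun S hS => ?_⟩
  have hS0 := hS.1
  have hθ0 : 0 < θ := by linarith
  have hb1 : 0 < exponentB p θ r - 1 := by linarith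
  have hpα : 0 < p - 1 + α := by linarith
  have hbound := le_constC_mul_of_forall_le_add
    (a := (eLpNorm u ∞ (volume.restrict Ω)).toReal)
    (M := (eLpNorm ω r (volume.restrict Ω)).toReal / S)
    (E := (volume Ω).toReal ^ ((exponentB p θ r - 1) / θ) *
      2 ^ (exponentB p θ r / (exponentB p θ r - 1))) hp hα (by positivity) (by positivity)
    fun k hk => by
      rw [← mul_assoc]
      exact ENNReal.toReal_le_of_le_ofReal (by positivity) (hu_sub.eLpNorm_top_le_add hΩ0 hΩt hp
        hα hr hθ0 hqθ.le hb hω hu hu_pos hS hk)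
  refine hbound.trans_eq ?_
  rw [Real.mul_rpow (by positivity) (by positivity), ← Real.rpow_mul ENNReal.toReal_nonneg,
    ← Real.rpow_mul (by norm_num), div_mul_div_comm, div_mul_div_comm]
  ring
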